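/- For real $y>0$ let $\vartheta_3(y)=\sum_{n\in\mathbb Z}e^{-\pi n^2y}$, and write $\mathbb R_+=\,]0,\infty[$. (1) Let $\kappa,\lambda\in\mathbb R$ with $1\le\kappa<\lambda$. Then the function $g\colon\mathbb R_+\to\mathbb R_+$, \[g(y)=\frac{\vartheta_3(\lambda y)\,\vartheta_3(y/\lambda)}{\vartheta_3(\kappa y)\,\vartheta_3(y/\kappa)},\] is well defined (positive), has a strict global maximum at $y=1$ (that is, $g(y)<g(1)$ for all $y\in\mathbb R_+\setminus\{1\}$), is strictly increasing on $]0,1]$, and is strictly decreasing on $[1,\infty[$. (2) Let $a,b\in\mathbb R_+$, and for $y\in\mathbb R_+$ let \[E_{a,b}(y)=\frac{\vartheta_3(y)\,\vartheta_3(aby)}{\vartheta_3(ay)\,\vartheta_3(by)}.\] The Hernandez--Sethuraman conjecture for $(a,b)$, that is, the assertion that $E_{a,b}$ attains its maximum over $\mathbb R_+$ at $y=1/\sqrt{ab}$ and at no other point, holds if and only if $a,b$ are both $>1$ or both $<1$. If $a<1<b$ or $b<1<a$, then $E_{a,b}$ instead has a strict global minimum over $\mathbb R_+$ at $y=1/\sqrt{ab}$.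 If $a=1$ or $b=1$, then $E_{a,b}$ is constant, equal to $1$. -/

import Mathlib

/-- The theta function `ϑ₃(y) = ∑_{n ∈ ℤ} exp(-π n² y)`, meant for real `y > 0`. -/
noncomputable def theta3 (y : ℝ) : ℝ :=
  ∑' n : ℤ, Real.exp (-Real.pi * (n : ℝ) ^ 2 * y)

/-- The series defining `ϑ₃(y)` converges for every `y > 0`. -/
theorem summable_theta3 {y : ℝ} (hy : 0 < y) :
    Summable fun n : ℤ => Real.exp (-Real.pi * (n : ℝ) ^ 2 * y) := by
  have h := summable_pow_mul_jacobiTheta₂_term_bound 0 hy 0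
  refine h.congr fun n => ?_
  simp only [pow_zero, one_mul]
  congr 1
  ring

/-- The function `ϑ₃` is positive on `ℝ₊`. -/
theorem theta3_pos {y : ℝ} (hy : 0 < y) : 0 < theta3 y :=
  (summable_theta3 hy).tsum_pos (fun _ => (Real.exp_pos _).le) 0 (Real.exp_pos _)

/-- `g(y) = ϑ₃(l y) ϑ₃(y / l) / (ϑ₃(k y) ϑ₃(y / k))`. -/
noncomputable def thetaQuotient (k l y : ℝ) : ℝ :=
  (theta3 (l * y) * theta3 (y / l)) / (theta3 (k * y) * theta3 (y / k))

/-- The expression `ϑ₃(y) ϑ₃(a b y) / (ϑ₃(a y) ϑ₃(b y))` of Hernandez and Sethuraman. -/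
noncomputable def hsQuotient (a b y : ℝ) : ℝ :=
  (theta3 y * theta3 (a * b * y)) / (theta3 (a * y) * theta3 (b * y))

/-- The function `f`, considered on `ℝ₊` only, has a strict global maximum at `x`; equivalently,
it attains its maximum over `ℝ₊` at `x` and nowhere else. -/
def HasStrictGlobalMaxAt (f : ℝ → ℝ) (x : ℝ) : Prop :=
  0 < x ∧ ∀ y : ℝ, 0 < y → y ≠ x → f y < f x

/-- The function `f`, considered on `ℝ₊` only, has a strict global minimum at `x`. -/
def HasStrictGlobalMinAt (f : ℝ → ℝ) (x : ℝ) : Prop :=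
  0 < x ∧ ∀ y : ℝ, 0 < y → y ≠ x → f x < f y

/-- The assertion of the Hernandez–Sethuraman conjecture for the parameters `a` and `b`:
the expression has its unique maximum over `ℝ₊` at `1 / √(a b)`. -/
def HernandezSethuraman (a b : ℝ) : Prop :=
  HasStrictGlobalMaxAt (hsQuotient a b) (1 / Real.sqrt (a * b))

/-! In the variable s = log y, Jacobi's identity ϑ₃(y) = y^(-1/2) ϑ₃(1/y) says that h(s) = log
ϑ₃(e^s) + s/4 (`logTheta`) is even. With u, K, L the logarithms of y, κ, λ, log g equals h(u+L) +
h(u-L) - h(u+K) - h(u-K), since the linear terms cancel.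

Everything rests on h'' being strictly decreasing on [0, ∞) (`strictAntiOn_logTheta₂`). As h'' is
even and |u-L| < u+L for u, L > 0, it follows that h'(u+L) + h'(u-L) strictly decreases in L ≥ 0, so
log g strictly decreases in u ≥ 0; evenness gives the other half.

With x = πe^s, h''' is a negative multiple of `thirdFactor x`. It vanishes at x = π because h''' is
odd, and e^x `thirdFactor x` strictly increases for x ≥ 3, so `thirdFactor` is positive beyond π.

The quotient E_{a,b} has the same form with shifts (log a ∓ log b)/2 and recentred u; the sign of
log a · log b decides which shift is larger in absolute value. -/

open Filter

/-! ### Gaussian moment series: derivatives and bounds -/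

/-- The series `∑_{n ≥ 1} n^{2k} exp(-n² x)`. -/
noncomputable def gaussMoment (k : ℕ) (x : ℝ) : ℝ :=
  ∑' n : ℕ, (((n : ℝ) + 1) ^ 2) ^ k * Real.exp (-((n : ℝ) + 1) ^ 2 * x)

theorem summable_gaussMoment (k : ℕ) {x : ℝ} (hx : 0 < x) :
    Summable fun n : ℕ => (((n : ℝ) + 1) ^ 2) ^ k * Real.exp (-((n : ℝ) + 1) ^ 2 * x) := by
  have h := (summable_nat_add_iff 1).2 (Real.summable_pow_mul_exp_neg_nat_mul (2 * k) hx)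
  refine Summable.of_nonneg_of_le (fun n => by positivity) (fun n => ?_) h
  rw [← pow_mul]
  push_cast
  refine mul_le_mul_of_nonneg_left (Real.exp_le_exp.2 ?_) (by positivity)
  have hn : (n : ℝ) + 1 ≤ ((n : ℝ) + 1) ^ 2 := by
    nlinarith [(Nat.cast_nonneg n : (0 : ℝ) ≤ n)]
  nlinarith [mul_le_mul_of_nonneg_right hn hx.le]

theorem hasDerivAt_gaussMoment (k : ℕ) {x : ℝ} (hx : 0 < x) :
    HasDerivAt (gaussMoment k) (-gaussMoment (k + 1) x) x := by
  have h2 : 0 < x / 2 := by positivity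
  -- On the half-line beyond x/2 the differentiated terms are dominated by their values at x/2.
  have key := hasDerivAt_tsum_of_isPreconnected (t := Set.Ioi (x / 2)) (y₀ := x) (y := x)
    (g := fun (n : ℕ) (z : ℝ) => (((n : ℝ) + 1) ^ 2) ^ k * Real.exp (-((n : ℝ) + 1) ^ 2 * z))
    (g' := fun (n : ℕ) (z : ℝ) =>
      -((((n : ℝ) + 1) ^ 2) ^ (k + 1) * Real.exp (-((n : ℝ) + 1) ^ 2 * z)))
    (summable_gaussMoment (k + 1) h2) isOpen_Ioi isPreconnected_Ioi
    (fun n z _ => by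
      have h := (((hasDerivAt_id' z).const_mul (-((n : ℝ) + 1) ^ 2)).exp).const_mul
        ((((n : ℝ) + 1) ^ 2) ^ k)
      refine h.congr_deriv ?_
      ring)
    (fun n z hz => by
      rw [norm_neg, Real.norm_of_nonneg (by positivity)]
      have hz' : x / 2 ≤ z := le_of_lt hz
      gcongr _ * Real.exp ?_
      nlinarith [sq_nonneg ((n : ℝ) + 1)])
    (by simp; linarith) (summable_gaussMoment k hx) (by simp; linarith)
  rw [tsum_neg] at key
  exact key

theorem gaussMoment_nonneg (k : ℕ) (x : ℝ) : 0 ≤ gaussMoment k x :=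
  tsum_nonneg fun n => by positivity

theorem gaussMoment_le_succ (k : ℕ) {x : ℝ} (hx : 0 < x) :
    gaussMoment k x ≤ gaussMoment (k + 1) x := by
  refine (summable_gaussMoment k hx).tsum_le_tsum (fun n => ?_) (summable_gaussMoment (k + 1) hx)
  gcongr
  · nlinarith [(Nat.cast_nonneg n : (0 : ℝ) ≤ n)]
  · omega

theorem exp_neg_le_gaussMoment (k : ℕ) {x : ℝ} (hx : 0 < x) : Real.exp (-x) ≤ gaussMoment k x := by
  have h := (summable_gaussMoment k hx).le_tsum 0 (fun n _ => by positivity)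
  simpa [gaussMoment] using h

/-- Write (n+2)² = 4 + u with u = n² + 4n. For k ≤ 4 the polynomial factor (1 + u/4)^k is at most
e^u, and e^(u-ux) ≤ e^(-n) ≤ 2^(-n), so a geometric series of sum 2 bounds the tail. -/
theorem gaussMoment_le (k : ℕ) (hk : k ≤ 4) {x : ℝ} (hx : 3 ≤ x) :
    gaussMoment k x ≤ Real.exp (-x) * (1 + 2 * 4 ^ k * Real.exp (-x) ^ 3) := by
  have hx0 : 0 < x := by linarith
  have hs := summable_gaussMoment k hx0
  have h0 : gaussMoment k x = _ := hs.tsum_eq_zero_add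
  have hg := (summable_geometric_two).mul_left ((4 : ℝ) ^ k * Real.exp (-x) ^ 4)
  have hle : ∑' n : ℕ, ((((n + 1 : ℕ) : ℝ) + 1) ^ 2) ^ k *
      Real.exp (-(((n + 1 : ℕ) : ℝ) + 1) ^ 2 * x) ≤ 4 ^ k * Real.exp (-x) ^ 4 * 2 := by
    rw [← tsum_geometric_two, ← tsum_mul_left]
    refine ((summable_nat_add_iff 1).2 hs).tsum_le_tsum (fun n => ?_) hg
    push_cast
    have hn : (0 : ℝ) ≤ n := Nat.cast_nonneg n
    set u : ℝ := (n : ℝ) ^ 2 + 4 * n with hu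
    have hu0 : 0 ≤ u := by positivity
    have e1 : ((n : ℝ) + 1 + 1) ^ 2 = 4 * (1 + u / 4) := by rw [hu]; ring
    have e2 : (1 + u / 4) ^ k ≤ Real.exp u := by
      calc (1 + u / 4) ^ k ≤ (1 + u / 4) ^ 4 := pow_le_pow_right₀ (by linarith) hk
        _ ≤ Real.exp (u / 4) ^ 4 := by
          gcongr
          linarith [Real.add_one_le_exp (u / 4)]
        _ = Real.exp u := by rw [← Real.exp_nat_mul]; congr 1; push_cast; ring
    have e3 : Real.exp (-n) ≤ (1 / 2) ^ n := by
      have : Real.exp (-1) ≤ 1 / 2 := by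
        rw [Real.exp_neg, one_div]
        exact inv_anti₀ (by norm_num) (by linarith [Real.add_one_le_exp (1 : ℝ)])
      calc Real.exp (-n) = Real.exp (-1) ^ n := by rw [← Real.exp_nat_mul]; congr 1; ring
        _ ≤ _ := by gcongr
    calc (((n : ℝ) + 1 + 1) ^ 2) ^ k * Real.exp (-((n : ℝ) + 1 + 1) ^ 2 * x)
        = 4 ^ k * Real.exp (-x) ^ 4 * ((1 + u / 4) ^ k * Real.exp (-u * x)) := by
          rw [neg_mul, e1, mul_pow, ← Real.exp_nat_mul]
          have : Real.exp (-(4 * (1 + u / 4) * x)) =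
              Real.exp (((4 : ℕ) : ℝ) * -x) * Real.exp (-u * x) := by
            rw [← Real.exp_add]; congr 1; push_cast; ring
          rw [this]; ring
      _ ≤ 4 ^ k * Real.exp (-x) ^ 4 * (Real.exp u * Real.exp (-u * x)) := by gcongr
      _ ≤ 4 ^ k * Real.exp (-x) ^ 4 * (1 / 2) ^ n := by
          gcongr
          refine le_trans ?_ e3
          rw [← Real.exp_add]
          gcongr
          nlinarith [mul_nonneg hu0 (sub_nonneg.2 hx), sq_nonneg (n : ℝ)]
  rw [h0]
  simp only [Nat.cast_zero, zero_add, one_pow, one_mul, neg_mul]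
  simp only [neg_mul] at hle
  have hw := Real.exp_pos (-x)
  nlinarith [hle]

/-! ### Sign of the third logarithmic derivative -/

/-- The factor of the third logarithmic derivative of `1 + 2 ∑_{n ≥ 1} exp(-n² x)` that
decides its sign. -/
noncomputable def thirdFactor (x : ℝ) : ℝ :=
  (x ^ 2 * gaussMoment 3 x - 3 * x * gaussMoment 2 x + gaussMoment 1 x) *
      (1 + 2 * gaussMoment 0 x) ^ 2 -
    6 * x * gaussMoment 1 x * (x * gaussMoment 2 x - gaussMoment 1 x) *
      (1 + 2 * gaussMoment 0 x) +
    8 * x ^ 2 * gaussMoment 1 x ^ 3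

/-- The derivative of `thirdFactor`. -/
noncomputable def thirdFactorDeriv (x : ℝ) : ℝ :=
  (5 * x * gaussMoment 3 x - x ^ 2 * gaussMoment 4 x - 4 * gaussMoment 2 x) *
      (1 + 2 * gaussMoment 0 x) ^ 2 -
    4 * (x ^ 2 * gaussMoment 3 x - 3 * x * gaussMoment 2 x + gaussMoment 1 x) *
      (1 + 2 * gaussMoment 0 x) * gaussMoment 1 x -
    6 * gaussMoment 1 x * (x * gaussMoment 2 x - gaussMoment 1 x) * (1 + 2 * gaussMoment 0 x) +
    6 * x * gaussMoment 2 x * (x * gaussMoment 2 x - gaussMoment 1 x) *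
      (1 + 2 * gaussMoment 0 x) -
    6 * x * gaussMoment 1 x * (2 * gaussMoment 2 x - x * gaussMoment 3 x) *
      (1 + 2 * gaussMoment 0 x) +
    12 * x * gaussMoment 1 x ^ 2 * (x * gaussMoment 2 x - gaussMoment 1 x) +
    16 * x * gaussMoment 1 x ^ 3 - 24 * x ^ 2 * gaussMoment 1 x ^ 2 * gaussMoment 2 x

theorem hasDerivAt_thirdFactor {x : ℝ} (hx : 0 < x) :
    HasDerivAt thirdFactor (thirdFactorDeriv x) x := by
  have d0 := hasDerivAt_gaussMoment 0 hx
  have d1 := hasDerivAt_gaussMoment 1 hx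
  have d2 := hasDerivAt_gaussMoment 2 hx
  have d3 := hasDerivAt_gaussMoment 3 hx
  have i := hasDerivAt_id' x
  have th := (d0.const_mul 2).const_add 1
  have q := (i.mul d2).sub d1
  have p := (((i.pow 2).mul d3).sub ((i.const_mul 3).mul d2)).add d1
  have h := ((p.mul (th.pow 2)).sub ((((i.const_mul 6).mul d1).mul q).mul th)).add
    (((i.pow 2).const_mul 8).mul (d1.pow 3))
  refine (h.congr_deriv ?_).congr_of_eventuallyEq (Eventually.of_forall fun z => ?_)
  · simp only [Pi.mul_apply, Pi.sub_apply, Pi.pow_apply, Pi.add_apply, thirdFactorDeriv]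
    norm_num
    ring
  · simp only [Pi.mul_apply, Pi.sub_apply, Pi.pow_apply, Pi.add_apply, thirdFactor]

theorem exp_neg_bounds {x : ℝ} (hx : 3 ≤ x) :
    Real.exp (-x) ≤ 1 / 20 ∧ x ^ 2 * Real.exp (-x) ≤ 9 / 20 := by
  have h3 : (20 : ℝ) ≤ Real.exp 3 := by
    have h1 := Real.exp_one_gt_d9
    have : Real.exp 3 = Real.exp 1 ^ 3 := by rw [← Real.exp_nat_mul]; norm_num
    rw [this]
    calc (20 : ℝ) ≤ 2.7182818283 ^ 3 := by norm_num
      _ ≤ _ := by gcongr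
  have hq := Real.quadratic_le_exp_of_nonneg (sub_nonneg.2 hx)
  have hE : Real.exp x = Real.exp 3 * Real.exp (x - 3) := by rw [← Real.exp_add]; congr 1; ring
  have hp : 20 * (1 + (x - 3) + (x - 3) ^ 2 / 2) ≤ Real.exp x := by
    rw [hE]
    exact mul_le_mul h3 hq (by nlinarith [sq_nonneg (x - 3)]) (Real.exp_pos _).le
  have hpos := Real.exp_pos x
  rw [Real.exp_neg]
  refine ⟨?_, ?_⟩
  · rw [inv_le_comm₀ hpos (by norm_num)]
    nlinarith [sq_nonneg (x - 3)]
  · rw [← div_eq_mul_inv, div_le_iff₀ hpos]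
    nlinarith [sq_nonneg (x - 3)]

/-- Here w = e^(-x) and r_k is the k-th moment divided by w; the expression is (`thirdFactor` +
`thirdFactorDeriv`)/w. At r_k = 1 the first bracket is 2x - 3. The w-term is nonnegative, and the
w²-term is too small to matter because x²w² ≤ 9/400. -/
theorem derivative_bound_aux {x w r0 r1 r2 r3 r4 : ℝ} (hx : 3 ≤ x) (hw : 0 < w)
    (hw1 : w ≤ 1 / 20) (hxxw : x ^ 2 * w ≤ 9 / 20) (h0 : 1 ≤ r0)
    (h1 : 1 ≤ r1) (h12 : r1 ≤ r2) (h23 : r2 ≤ r3) (h2 : r2 ≤ 1.004)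
    (h4 : r4 ≤ 1 + 512 * w ^ 3) :
    0 < (x ^ 2 * (r3 - r4) + x * (5 * r3 - 3 * r2) - 4 * r2 + r1) * (1 + 2 * (w * r0)) ^ 2 +
      w * (1 + 2 * (w * r0)) * ((2 * r1 * r3 + 6 * r2 * (r2 - r1)) * x ^ 2 -
        (12 * r1 * r2 - 6 * r1 ^ 2) * x + 2 * r1 ^ 2) +
      w ^ 2 * (12 * x * r1 ^ 2 * (x * r2 - r1) + 16 * x * r1 ^ 3 - 24 * x ^ 2 * r1 ^ 2 * r2 +
        8 * x ^ 2 * r1 ^ 3) := by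
  have hx0 : 0 < x := by linarith
  -- 0.576 = 512 · (9/20) · (1/20)².
  have hr4 : x ^ 2 * (r4 - r3) ≤ 0.576 := by
    have : x ^ 2 * (r4 - r3) ≤ x ^ 2 * (512 * w ^ 3) := by
      gcongr; linarith
    have h' : x ^ 2 * w * w ^ 2 ≤ 9 / 20 * (1 / 20) ^ 2 := by gcongr
    nlinarith
  have hx3 : x * (5 * r3 - 3 * r2) ≥ 2 * x := by nlinarith
  have hA : 2 * x - 3.6 ≤ x ^ 2 * (r3 - r4) + x * (5 * r3 - 3 * r2) - 4 * r2 + r1 := by nlinarith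
  set A := x ^ 2 * (r3 - r4) + x * (5 * r3 - 3 * r2) - 4 * r2 + r1 with hAdef
  have hth : 1 ≤ 1 + 2 * (w * r0) := by
    have : 0 ≤ w * r0 := by positivity
    linarith
  have t1 : 2 * x - 3.6 ≤ A * (1 + 2 * (w * r0)) ^ 2 := by
    have : 1 ≤ (1 + 2 * (w * r0)) ^ 2 := one_le_pow₀ hth
    nlinarith
  have hB : 0 ≤ (2 * r1 * r3 + 6 * r2 * (r2 - r1)) * x ^ 2 -
        (12 * r1 * r2 - 6 * r1 ^ 2) * x + 2 * r1 ^ 2 := by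
    have c1 : 2 ≤ 2 * r1 * r3 + 6 * r2 * (r2 - r1) := by nlinarith
    have c2 : 12 * r1 * r2 - 6 * r1 ^ 2 ≤ 6.2 := by nlinarith
    have c3 : 2 ≤ 2 * r1 ^ 2 := by nlinarith
    have c4 : 2 * x ^ 2 ≤ (2 * r1 * r3 + 6 * r2 * (r2 - r1)) * x ^ 2 := by gcongr
    have c5 : (12 * r1 * r2 - 6 * r1 ^ 2) * x ≤ 6.2 * x := by gcongr
    nlinarith
  have t2 := mul_nonneg (mul_nonneg hw.le (by linarith : 0 ≤ 1 + 2 * (w * r0))) hB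
  have hC : -24.6 * x ^ 2 ≤ 12 * x * r1 ^ 2 * (x * r2 - r1) + 16 * x * r1 ^ 3 -
      24 * x ^ 2 * r1 ^ 2 * r2 + 8 * x ^ 2 * r1 ^ 3 := by
    have a1 : 0 ≤ 12 * x * r1 ^ 2 * (x * r2 - r1) := by
      have : 0 ≤ x * r2 - r1 := by nlinarith
      positivity
    have a2 : 0 ≤ 16 * x * r1 ^ 3 := by positivity
    have a3 : 0 ≤ 8 * x ^ 2 * r1 ^ 3 := by positivity
    have a4 : r1 ^ 2 * r2 ≤ 1.004 ^ 2 * 1.004 := by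
      have : r1 ≤ 1.004 := by linarith
      have : 0 ≤ r2 := by linarith
      gcongr
    have a5 : x ^ 2 * (r1 ^ 2 * r2) ≤ x ^ 2 * (1.004 ^ 2 * 1.004) := by gcongr
    nlinarith [sq_nonneg x]
  have t3 := mul_le_mul_of_nonneg_left hC (sq_nonneg w)
  have t4 : x ^ 2 * w * w ≤ 9 / 20 * (1 / 20) := by gcongr
  nlinarith

theorem thirdFactor_add_deriv_pos {x : ℝ} (hx : 3 ≤ x) :
    0 < thirdFactor x + thirdFactorDeriv x := by
  have hx0 : 0 < x := by linarith
  obtain ⟨b1, b2⟩ := exp_neg_bounds hx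
  have hw := Real.exp_pos (-x)
  have h0 := exp_neg_le_gaussMoment 0 hx0
  have h1 := exp_neg_le_gaussMoment 1 hx0
  have h12 := gaussMoment_le_succ 1 hx0
  have h23 := gaussMoment_le_succ 2 hx0
  have h2 := gaussMoment_le 2 (by norm_num) hx
  have h4 := gaussMoment_le 4 le_rfl hx
  unfold thirdFactor thirdFactorDeriv
  norm_num at h12 h23
  set w := Real.exp (-x)
  have hsc : ∀ k, ∃ r, gaussMoment k x = w * r := fun k =>
    ⟨gaussMoment k x / w, by field_simp⟩
  obtain ⟨r0, e0⟩ := hsc 0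
  obtain ⟨r1, e1⟩ := hsc 1
  obtain ⟨r2, e2⟩ := hsc 2
  obtain ⟨r3, e3⟩ := hsc 3
  obtain ⟨r4, e4⟩ := hsc 4
  rw [e0] at h0 ⊢
  rw [e1] at h1 h12 ⊢
  rw [e2] at h2 h12 h23 ⊢
  rw [e3] at h23 ⊢
  rw [e4] at h4 ⊢
  have key := derivative_bound_aux (r0 := r0) (r1 := r1) (r2 := r2) (r3 := r3) (r4 := r4)
    hx hw b1 b2 (by nlinarith) (by nlinarith) (le_of_mul_le_mul_left h12 hw)
    (le_of_mul_le_mul_left h23 hw)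
    ((le_of_mul_le_mul_left h2 hw).trans (by
      have : w ^ 3 ≤ (1 / 20) ^ 3 := by gcongr
      norm_num at this ⊢
      linarith))
    ((le_of_mul_le_mul_left h4 hw).trans (by norm_num))
  have := mul_pos hw key
  refine this.trans_eq ?_
  ring

/-- The factor e^x removes the leading decay: `thirdFactor x` behaves like (x² - 3x + 1)e^(-x). -/
theorem strictMonoOn_thirdFactor_mul_exp :
    StrictMonoOn (fun x => thirdFactor x * Real.exp x) (Set.Ici 3) := by
  have hd : ∀ x : ℝ, 3 ≤ x → HasDerivAt (fun x => thirdFactor x * Real.exp x)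
      ((thirdFactor x + thirdFactorDeriv x) * Real.exp x) x := fun x hx =>
    ((hasDerivAt_thirdFactor (by linarith)).mul (Real.hasDerivAt_exp x)).congr_deriv (by ring)
  refine strictMonoOn_of_deriv_pos (convex_Ici 3)
    (fun x hx => (hd x hx).continuousAt.continuousWithinAt) fun x hx => ?_
  rw [interior_Ici] at hx
  rw [(hd x (le_of_lt hx)).deriv]
  exact mul_pos (thirdFactor_add_deriv_pos (le_of_lt hx)) (Real.exp_pos x)

/-! ### Evenness and derivatives of the normalized log ϑ₃ -/

theorem theta3_eq_gaussMoment {y : ℝ} (hy : 0 < y) :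
    theta3 y = 1 + 2 * gaussMoment 0 (Real.pi * y) := by
  unfold theta3
  have he : (fun n : ℤ => Real.exp (-Real.pi * (n : ℝ) ^ 2 * y)).Even := fun n => by simp
  have h := tsum_pnat_eq_tsum_succ
    (f := fun n : ℕ => Real.exp (-Real.pi * (((n : ℕ) : ℤ) : ℝ) ^ 2 * y))
  rw [tsum_int_eq_zero_add_two_mul_tsum_pnat he (summable_theta3 hy), h]
  have hg : ∑' n : ℕ, Real.exp (-Real.pi * ((((n + 1 : ℕ) : ℕ) : ℤ) : ℝ) ^ 2 * y) =
      gaussMoment 0 (Real.pi * y) := by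
    refine tsum_congr fun n => ?_
    rw [pow_zero, one_mul]
    congr 1
    push_cast
    ring
  rw [hg]
  simp

theorem theta3_inv {y : ℝ} (hy : 0 < y) : theta3 y = 1 / y ^ (1 / 2 : ℝ) * theta3 y⁻¹ := by
  unfold theta3
  have h := Real.tsum_exp_neg_mul_int_sq hy
  convert h using 4 <;> ring_nf

/-- The logarithm of `ϑ₃` in the logarithmic variable, normalized to be even. -/
noncomputable def logTheta (s : ℝ) : ℝ := Real.log (theta3 (Real.exp s)) + s / 4

/-- Jacobi's identity contributes -s/2, which the two terms ±s/4 absorb. -/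
theorem logTheta_neg (s : ℝ) : logTheta (-s) = logTheta s := by
  have h := theta3_inv (Real.exp_pos s)
  have hp := theta3_pos (Real.exp_pos (-s))
  unfold logTheta
  rw [h, ← Real.exp_neg, ← Real.exp_mul, Real.log_mul (by positivity) hp.ne', one_div,
    ← Real.exp_neg, Real.log_exp]
  ring

/-- The first derivative of `logTheta`. -/
noncomputable def logTheta₁ (s : ℝ) : ℝ :=
  -2 * (Real.pi * Real.exp s) * gaussMoment 1 (Real.pi * Real.exp s) /
    (1 + 2 * gaussMoment 0 (Real.pi * Real.exp s)) + 1 / 4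

/-- The second derivative of `logTheta`. -/
noncomputable def logTheta₂ (s : ℝ) : ℝ :=
  (2 * (Real.pi * Real.exp s) ^ 2 * gaussMoment 2 (Real.pi * Real.exp s) -
      2 * (Real.pi * Real.exp s) * gaussMoment 1 (Real.pi * Real.exp s)) /
    (1 + 2 * gaussMoment 0 (Real.pi * Real.exp s)) -
  4 * (Real.pi * Real.exp s) ^ 2 * gaussMoment 1 (Real.pi * Real.exp s) ^ 2 /
    (1 + 2 * gaussMoment 0 (Real.pi * Real.exp s)) ^ 2

/-- The third derivative of `logTheta`. -/
noncomputable def logTheta₃ (s : ℝ) : ℝ :=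
  -2 * (Real.pi * Real.exp s) * thirdFactor (Real.pi * Real.exp s) /
    (1 + 2 * gaussMoment 0 (Real.pi * Real.exp s)) ^ 3

theorem one_add_gaussMoment_pos (x : ℝ) : 0 < 1 + 2 * gaussMoment 0 x := by
  linarith [gaussMoment_nonneg 0 x]

theorem hasDerivAt_gaussMoment_pi_mul_exp (k : ℕ) (s : ℝ) :
    HasDerivAt (fun s => gaussMoment k (Real.pi * Real.exp s))
      (-gaussMoment (k + 1) (Real.pi * Real.exp s) * (Real.pi * Real.exp s)) s :=
  HasDerivAt.comp (h₂ := gaussMoment k) s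
    (hasDerivAt_gaussMoment k (mul_pos Real.pi_pos (Real.exp_pos s)))
    ((Real.hasDerivAt_exp s).const_mul Real.pi)

theorem hasDerivAt_logTheta (s : ℝ) : HasDerivAt logTheta (logTheta₁ s) s := by
  have hθ := one_add_gaussMoment_pos (Real.pi * Real.exp s)
  have h := ((((hasDerivAt_gaussMoment_pi_mul_exp 0 s).const_mul 2).const_add 1).log hθ.ne').add
    ((hasDerivAt_id' s).div_const 4)
  refine (h.congr_deriv ?_).congr_of_eventuallyEq (Eventually.of_forall fun z => ?_)
  · simp only [logTheta₁, zero_add]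
    ring
  · simp only [Pi.add_apply, logTheta, theta3_eq_gaussMoment (Real.exp_pos z)]

theorem hasDerivAt_logTheta₁ (s : ℝ) : HasDerivAt logTheta₁ (logTheta₂ s) s := by
  have hθ := (one_add_gaussMoment_pos (Real.pi * Real.exp s)).ne'
  have dX := (Real.hasDerivAt_exp s).const_mul Real.pi
  have d0 := ((hasDerivAt_gaussMoment_pi_mul_exp 0 s).const_mul 2).const_add 1
  have d1 := hasDerivAt_gaussMoment_pi_mul_exp 1 s
  have h := (((dX.const_mul (-2)).mul d1).div d0 hθ).add_const (1 / 4)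
  refine (h.congr_deriv ?_).congr_of_eventuallyEq (Eventually.of_forall fun z => ?_)
  · simp only [Pi.mul_apply, logTheta₂, zero_add]
    norm_num
    field_simp
    ring
  · simp only [Pi.mul_apply, Pi.div_apply, logTheta₁]

theorem hasDerivAt_logTheta₂ (s : ℝ) : HasDerivAt logTheta₂ (logTheta₃ s) s := by
  have hθ := (one_add_gaussMoment_pos (Real.pi * Real.exp s)).ne'
  have dX := (Real.hasDerivAt_exp s).const_mul Real.pi
  have d0 := ((hasDerivAt_gaussMoment_pi_mul_exp 0 s).const_mul 2).const_add 1
  have d1 := hasDerivAt_gaussMoment_pi_mul_exp 1 s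
  have d2 := hasDerivAt_gaussMoment_pi_mul_exp 2 s
  have h := ((((((dX.pow 2).const_mul 2).mul d2).sub ((dX.const_mul 2).mul d1)).div d0 hθ)).sub
    ((((dX.pow 2).const_mul 4).mul (d1.pow 2)).div (d0.pow 2) (pow_ne_zero 2 hθ))
  refine (h.congr_deriv ?_).congr_of_eventuallyEq (Eventually.of_forall fun z => ?_)
  · simp only [Pi.mul_apply, Pi.sub_apply, Pi.pow_apply, logTheta₃, thirdFactor, zero_add]
    norm_num
    field_simp
    ring
  · simp only [Pi.mul_apply, Pi.sub_apply, Pi.pow_apply, Pi.div_apply, logTheta₂]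

/-- With c = ±1 recording parity, differentiation flips it; iterating from `logTheta` shows that the
third derivative is odd. -/
theorem HasDerivAt.neg_of_symm {f f' : ℝ → ℝ} {c : ℝ} (hf : ∀ s, HasDerivAt f (f' s) s)
    (hs : ∀ s, f (-s) = c * f s) (s : ℝ) : f' (-s) = -c * f' s := by
  have h1 : HasDerivAt (fun s => f (-s)) (f' (-s) * -1) s :=
    (hf (-s)).comp s (hasDerivAt_neg s)
  have h2 : HasDerivAt (fun s => f (-s)) (c * f' s) s := by
    simp only [hs]
    exact (hf s).const_mul c
  linarith [h1.unique h2]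

theorem logTheta₂_neg (s : ℝ) : logTheta₂ (-s) = logTheta₂ s := by
  have h1 := HasDerivAt.neg_of_symm (c := 1) hasDerivAt_logTheta
    (fun s => by rw [logTheta_neg, one_mul])
  have h2 := HasDerivAt.neg_of_symm hasDerivAt_logTheta₁ h1 s
  linarith

theorem logTheta₃_zero : logTheta₃ 0 = 0 := by
  have h := HasDerivAt.neg_of_symm (c := 1) hasDerivAt_logTheta₂
    (fun s => by rw [logTheta₂_neg, one_mul]) 0
  rw [neg_zero] at h
  linarith

/-- x = π is s = 0, where the odd third derivative vanishes; no numerical evaluation is needed. -/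
theorem thirdFactor_pi : thirdFactor Real.pi = 0 := by
  have h := logTheta₃_zero
  have hθ := one_add_gaussMoment_pos Real.pi
  simp only [logTheta₃, Real.exp_zero, mul_one, div_eq_zero_iff, mul_eq_zero] at h
  rcases h with (h | h) | h
  · rcases h with h | h
    · norm_num at h
    · exact absurd h Real.pi_ne_zero
  · exact h
  · exact absurd h (by positivity)

theorem thirdFactor_pos {x : ℝ} (hx : Real.pi < x) : 0 < thirdFactor x := by
  have h3 := Real.pi_gt_three
  have h := strictMonoOn_thirdFactor_mul_exp (Set.mem_Ici.2 h3.le)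
    (Set.mem_Ici.2 (h3.trans hx).le) hx
  simp only [thirdFactor_pi, zero_mul] at h
  exact pos_of_mul_pos_left h (Real.exp_pos x).le

theorem strictAntiOn_logTheta₂ : StrictAntiOn logTheta₂ (Set.Ici 0) := by
  refine strictAntiOn_of_deriv_neg (convex_Ici 0)
    (fun x _ => (hasDerivAt_logTheta₂ x).continuousAt.continuousWithinAt) fun s hs => ?_
  rw [interior_Ici] at hs
  rw [(hasDerivAt_logTheta₂ s).deriv, logTheta₃]
  have hX : Real.pi < Real.pi * Real.exp s :=
    lt_mul_of_one_lt_right Real.pi_pos (Real.one_lt_exp_iff.2 hs)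
  have h1 := thirdFactor_pos hX
  have h2 := one_add_gaussMoment_pos (Real.pi * Real.exp s)
  have h3 := Real.pi_pos.trans hX
  refine div_neg_of_neg_of_pos ?_ (by positivity)
  have := mul_pos h3 h1
  linarith

/-! ### Monotonicity of the theta quotient -/

theorem strictAntiOn_logTheta₁_add {u : ℝ} (hu : 0 < u) :
    StrictAntiOn (fun L => logTheta₁ (u + L) + logTheta₁ (u - L)) (Set.Ici 0) := by
  have hd : ∀ L, HasDerivAt (fun L => logTheta₁ (u + L) + logTheta₁ (u - L))
      (logTheta₂ (u + L) - logTheta₂ (u - L)) L := fun L =>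
    (((hasDerivAt_logTheta₁ (u + L)).comp_const_add u L).add
      ((hasDerivAt_logTheta₁ (u - L)).comp_const_sub u L)).congr_deriv (by ring)
  refine strictAntiOn_of_deriv_neg (convex_Ici 0)
    (fun x _ => (hd x).continuousAt.continuousWithinAt) fun L hL => ?_
  rw [interior_Ici] at hL
  have hL : 0 < L := hL
  rw [(hd L).deriv, sub_neg]
  -- Evenness moves both arguments into [0, ∞), where the second derivative is strictly decreasing.
  have habs : logTheta₂ (u - L) = logTheta₂ |u - L| := by
    rcases abs_choice (u - L) with h | h <;> rw [h]
    rw [logTheta₂_neg]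
  rw [habs]
  exact strictAntiOn_logTheta₂ (Set.mem_Ici.2 (abs_nonneg _)) (Set.mem_Ici.2 (by linarith))
    (abs_lt.2 ⟨by linarith, by linarith⟩)

/-- The logarithm of the quotient of theta functions in logarithmic variables. -/
noncomputable def logThetaQuotient (K L u : ℝ) : ℝ :=
  logTheta (u + L) + logTheta (u - L) - (logTheta (u + K) + logTheta (u - K))

theorem logThetaQuotient_neg (K L u : ℝ) :
    logThetaQuotient K L (-u) = logThetaQuotient K L u := by
  unfold logThetaQuotient
  rw [← logTheta_neg (-u + L), ← logTheta_neg (-u - L), ← logTheta_neg (-u + K),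
    ← logTheta_neg (-u - K)]
  ring_nf

theorem strictAntiOn_logThetaQuotient {K L : ℝ} (hK : 0 ≤ K) (hKL : K < L) :
    StrictAntiOn (logThetaQuotient K L) (Set.Ici 0) := by
  have hd : ∀ u, HasDerivAt (logThetaQuotient K L)
      (logTheta₁ (u + L) + logTheta₁ (u - L) - (logTheta₁ (u + K) + logTheta₁ (u - K))) u :=
    fun u => (((hasDerivAt_logTheta _).comp_add_const u L).add
      ((hasDerivAt_logTheta _).comp_sub_const u L)).sub
      (((hasDerivAt_logTheta _).comp_add_const u K).add
      ((hasDerivAt_logTheta _).comp_sub_const u K))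
  refine strictAntiOn_of_deriv_neg (convex_Ici 0)
    (fun x _ => (hd x).continuousAt.continuousWithinAt) fun u hu => ?_
  rw [interior_Ici] at hu
  rw [(hd u).deriv, sub_neg]
  exact strictAntiOn_logTheta₁_add hu (Set.mem_Ici.2 hK) (Set.mem_Ici.2 (hK.trans hKL.le)) hKL

theorem thetaQuotient_pos {k l y : ℝ} (hk : 0 < k) (hl : 0 < l) (hy : 0 < y) :
    0 < thetaQuotient k l y :=
  div_pos (mul_pos (theta3_pos (mul_pos hl hy)) (theta3_pos (div_pos hy hl)))
    (mul_pos (theta3_pos (mul_pos hk hy)) (theta3_pos (div_pos hy hk)))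

theorem log_theta3 {y : ℝ} (hy : 0 < y) :
    Real.log (theta3 y) = logTheta (Real.log y) - Real.log y / 4 := by
  rw [logTheta, Real.exp_log hy]
  ring

theorem log_thetaQuotient {k l y : ℝ} (hk : 0 < k) (hl : 0 < l) (hy : 0 < y) :
    Real.log (thetaQuotient k l y) =
      logThetaQuotient (Real.log k) (Real.log l) (Real.log y) := by
  have p1 := mul_pos hl hy
  have p2 := div_pos hy hl
  have p3 := mul_pos hk hy
  have p4 := div_pos hy hk
  have q1 := (theta3_pos p1).ne'
  have q2 := (theta3_pos p2).ne'
  have q3 := (theta3_pos p3).ne'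
  have q4 := (theta3_pos p4).ne'
  rw [thetaQuotient, Real.log_div (mul_ne_zero q1 q2) (mul_ne_zero q3 q4), Real.log_mul q1 q2,
    Real.log_mul q3 q4, log_theta3 p1, log_theta3 p2, log_theta3 p3, log_theta3 p4,
    Real.log_mul hl.ne' hy.ne', Real.log_mul hk.ne' hy.ne', Real.log_div hy.ne' hl.ne',
    Real.log_div hy.ne' hk.ne', logThetaQuotient, add_comm (Real.log l), add_comm (Real.log k)]
  ring

theorem thetaQuotient_inv {k l y : ℝ} (hk : 0 < k) (hl : 0 < l) (hy : 0 < y) :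
    thetaQuotient k l y⁻¹ = thetaQuotient k l y := by
  refine Real.log_injOn_pos (thetaQuotient_pos hk hl (inv_pos.2 hy))
    (thetaQuotient_pos hk hl hy) ?_
  rw [log_thetaQuotient hk hl hy, log_thetaQuotient hk hl (inv_pos.2 hy), Real.log_inv,
    logThetaQuotient_neg]

theorem strictAntiOn_thetaQuotient {k l : ℝ} (hk : 1 ≤ k) (hkl : k < l) :
    StrictAntiOn (thetaQuotient k l) (Set.Ici 1) := by
  intro x hx y hy hxy
  have hx : 1 ≤ x := hx
  have hk0 : 0 < k := by linarith
  have hl0 : 0 < l := by linarith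
  have hx0 : 0 < x := by linarith
  have hy0 : 0 < y := by linarith
  rw [← Real.log_lt_log_iff (thetaQuotient_pos hk0 hl0 hy0) (thetaQuotient_pos hk0 hl0 hx0),
    log_thetaQuotient hk0 hl0 hx0, log_thetaQuotient hk0 hl0 hy0]
  exact strictAntiOn_logThetaQuotient (Real.log_nonneg hk) (Real.log_lt_log hk0 hkl)
    (Set.mem_Ici.2 (Real.log_nonneg hx)) (Set.mem_Ici.2 (Real.log_nonneg hy))
    (Real.log_lt_log hx0 hxy)

theorem strictMonoOn_thetaQuotient {k l : ℝ} (hk : 1 ≤ k) (hkl : k < l) :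
    StrictMonoOn (thetaQuotient k l) (Set.Ioc 0 1) := by
  intro x hx y hy hxy
  have hk0 : 0 < k := by linarith
  have hl0 : 0 < l := by linarith
  rw [← thetaQuotient_inv hk0 hl0 hx.1, ← thetaQuotient_inv hk0 hl0 hy.1]
  exact strictAntiOn_thetaQuotient hk hkl (Set.mem_Ici.2 ((one_le_inv₀ hy.1).2 hy.2))
    (Set.mem_Ici.2 ((one_le_inv₀ hx.1).2 hx.2)) ((inv_lt_inv₀ hy.1 hx.1).2 hxy)

theorem hasStrictGlobalMaxAt_thetaQuotient {k l : ℝ} (hk : 1 ≤ k) (hkl : k < l) :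
    HasStrictGlobalMaxAt (thetaQuotient k l) 1 := by
  refine ⟨one_pos, fun y hy hne => ?_⟩
  rcases lt_or_gt_of_ne hne with h | h
  · exact strictMonoOn_thetaQuotient hk hkl ⟨hy, h.le⟩ ⟨one_pos, le_rfl⟩ h
  · exact strictAntiOn_thetaQuotient hk hkl (Set.mem_Ici.2 le_rfl) (Set.mem_Ici.2 h.le) h

/-! ### The Hernandez–Sethuraman quotient -/

theorem hsQuotient_pos {a b y : ℝ} (ha : 0 < a) (hb : 0 < b) (hy : 0 < y) :
    0 < hsQuotient a b y :=
  div_pos (mul_pos (theta3_pos hy) (theta3_pos (by positivity)))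
    (mul_pos (theta3_pos (mul_pos ha hy)) (theta3_pos (mul_pos hb hy)))

/-- The logarithms of y and aby are symmetric about the same midpoint as those of ay and by; that
midpoint is the new u. -/
theorem log_hsQuotient {a b y : ℝ} (ha : 0 < a) (hb : 0 < b) (hy : 0 < y) :
    Real.log (hsQuotient a b y) =
      logThetaQuotient ((Real.log a - Real.log b) / 2) ((Real.log a + Real.log b) / 2)
        (Real.log y + (Real.log a + Real.log b) / 2) := by
  have p1 := mul_pos (mul_pos ha hb) hy
  have p3 := mul_pos ha hy
  have p4 := mul_pos hb hy
  have q1 := (theta3_pos p1).ne'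
  have q2 := (theta3_pos hy).ne'
  have q3 := (theta3_pos p3).ne'
  have q4 := (theta3_pos p4).ne'
  rw [hsQuotient, Real.log_div (mul_ne_zero q2 q1) (mul_ne_zero q3 q4), Real.log_mul q2 q1,
    Real.log_mul q3 q4, log_theta3 p1, log_theta3 hy, log_theta3 p3, log_theta3 p4,
    Real.log_mul (mul_pos ha hb).ne' hy.ne', Real.log_mul ha.ne' hb.ne',
    Real.log_mul ha.ne' hy.ne', Real.log_mul hb.ne' hy.ne', logThetaQuotient]
  ring_nf

theorem logThetaQuotient_abs (K L u : ℝ) :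
    logThetaQuotient |K| |L| u = logThetaQuotient K L u := by
  unfold logThetaQuotient
  rcases abs_choice K with h | h <;> rcases abs_choice L with h' | h' <;> rw [h, h'] <;> ring_nf

/-- Exchanging the shifts turns the maximum into a minimum. -/
theorem logThetaQuotient_swap (K L u : ℝ) :
    logThetaQuotient L K u = -logThetaQuotient K L u := by
  unfold logThetaQuotient
  ring

theorem logThetaQuotient_lt_zero {K L u : ℝ} (hKL : |K| < |L|) (hu : u ≠ 0) :
    logThetaQuotient K L u < logThetaQuotient K L 0 := by
  rw [← logThetaQuotient_abs K L u, ← logThetaQuotient_abs K L 0]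
  have h := strictAntiOn_logThetaQuotient (abs_nonneg K) hKL (Set.mem_Ici.2 le_rfl)
    (Set.mem_Ici.2 (abs_nonneg u)) (abs_pos.2 hu)
  rcases abs_choice u with h' | h' <;> rw [h'] at h
  · exact h
  · rwa [logThetaQuotient_neg] at h

theorem log_inv_sqrt_mul {a b : ℝ} (ha : 0 < a) (hb : 0 < b) :
    Real.log (1 / Real.sqrt (a * b)) + (Real.log a + Real.log b) / 2 = 0 := by
  rw [one_div, Real.log_inv, Real.log_sqrt (by positivity), Real.log_mul ha.ne' hb.ne']
  ring

theorem log_add_ne_zero {a b y : ℝ} (ha : 0 < a) (hb : 0 < b) (hy : 0 < y)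
    (hne : y ≠ 1 / Real.sqrt (a * b)) : Real.log y + (Real.log a + Real.log b) / 2 ≠ 0 := by
  intro h
  refine hne (Real.log_injOn_pos hy (by simp only [Set.mem_Ioi]; positivity) ?_)
  linarith [log_inv_sqrt_mul ha hb]

theorem abs_sub_lt_abs_add {α β : ℝ} (h : 0 < α * β) : |(α - β) / 2| < |(α + β) / 2| :=
  sq_lt_sq.1 (by nlinarith)

theorem abs_add_lt_abs_sub {α β : ℝ} (h : α * β < 0) : |(α + β) / 2| < |(α - β) / 2| :=
  sq_lt_sq.1 (by nlinarith)

theorem hernandezSethuraman_of_log_mul_log_pos {a b : ℝ} (ha : 0 < a) (hb : 0 < b)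
    (h : 0 < Real.log a * Real.log b) : HernandezSethuraman a b := by
  have hp : 0 < 1 / Real.sqrt (a * b) := by positivity
  refine ⟨hp, fun y hy hne => ?_⟩
  rw [← Real.log_lt_log_iff (hsQuotient_pos ha hb hy) (hsQuotient_pos ha hb hp),
    log_hsQuotient ha hb hy, log_hsQuotient ha hb hp, log_inv_sqrt_mul ha hb]
  exact logThetaQuotient_lt_zero (abs_sub_lt_abs_add h) (log_add_ne_zero ha hb hy hne)

theorem hasStrictGlobalMinAt_of_log_mul_log_neg {a b : ℝ} (ha : 0 < a) (hb : 0 < b)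
    (h : Real.log a * Real.log b < 0) :
    HasStrictGlobalMinAt (hsQuotient a b) (1 / Real.sqrt (a * b)) := by
  have hp : 0 < 1 / Real.sqrt (a * b) := by positivity
  refine ⟨hp, fun y hy hne => ?_⟩
  rw [← Real.log_lt_log_iff (hsQuotient_pos ha hb hp) (hsQuotient_pos ha hb hy),
    log_hsQuotient ha hb hy, log_hsQuotient ha hb hp, log_inv_sqrt_mul ha hb,
    logThetaQuotient_swap, logThetaQuotient_swap _ _ (Real.log y + _)]
  exact neg_lt_neg
    (logThetaQuotient_lt_zero (abs_add_lt_abs_sub h) (log_add_ne_zero ha hb hy hne))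

theorem hsQuotient_eq_one {a b y : ℝ} (ha : 0 < a) (hb : 0 < b) (hy : 0 < y)
    (h : a = 1 ∨ b = 1) : hsQuotient a b y = 1 := by
  have h0 := (theta3_pos hy).ne'
  have h1 := (theta3_pos (mul_pos ha hy)).ne'
  have h2 := (theta3_pos (mul_pos hb hy)).ne'
  rcases h with rfl | rfl
  · simp only [hsQuotient, one_mul]
    exact div_self (mul_ne_zero h0 h2)
  · simp only [hsQuotient, mul_one, one_mul]
    rw [mul_comm]
    exact div_self (mul_ne_zero h1 h0)

theorem HasStrictGlobalMinAt.not_max {f : ℝ → ℝ} {x : ℝ} (hf : HasStrictGlobalMinAt f x) :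
    ¬HasStrictGlobalMaxAt f x := fun h =>
  lt_asymm (hf.2 (x + 1) (by linarith [hf.1]) (by simp))
    (h.2 (x + 1) (by linarith [hf.1]) (by simp))

theorem mainTheorem1 :
    (∀ k l : ℝ, 1 ≤ k → k < l →
      (∀ y : ℝ, 0 < y → 0 < thetaQuotient k l y) ∧
      HasStrictGlobalMaxAt (thetaQuotient k l) 1 ∧
      StrictMonoOn (thetaQuotient k l) (Set.Ioc 0 1) ∧
      StrictAntiOn (thetaQuotient k l) (Set.Ici 1)) ∧
    (∀ a b : ℝ, 0 < a → 0 < b →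
      (HernandezSethuraman a b ↔ (1 < a ∧ 1 < b) ∨ (a < 1 ∧ b < 1)) ∧
      ((a < 1 ∧ 1 < b) ∨ (b < 1 ∧ 1 < a) →
        HasStrictGlobalMinAt (hsQuotient a b) (1 / Real.sqrt (a * b))) ∧
      (a = 1 ∨ b = 1 → ∀ y : ℝ, 0 < y → hsQuotient a b y = 1)) := by
  refine ⟨fun k l hk hkl => ⟨fun y hy => thetaQuotient_pos (by linarith) (by linarith) hy,
    hasStrictGlobalMaxAt_thetaQuotient hk hkl, strictMonoOn_thetaQuotient hk hkl,
    strictAntiOn_thetaQuotient hk hkl⟩, fun a b ha hb => ?_⟩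
  have hmin : (a < 1 ∧ 1 < b) ∨ (b < 1 ∧ 1 < a) →
      HasStrictGlobalMinAt (hsQuotient a b) (1 / Real.sqrt (a * b)) := by
    intro h
    refine hasStrictGlobalMinAt_of_log_mul_log_neg ha hb ?_
    rcases h with ⟨h1, h2⟩ | ⟨h1, h2⟩
    · exact mul_neg_of_neg_of_pos (Real.log_neg ha h1) (Real.log_pos h2)
    · exact mul_neg_of_pos_of_neg (Real.log_pos h2) (Real.log_neg hb h1)
  refine ⟨⟨fun h => ?_, fun h => hernandezSethuraman_of_log_mul_log_pos ha hb ?_⟩, hmin,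
    fun h y hy => hsQuotient_eq_one ha hb hy h⟩
  · have hone : ¬(a = 1 ∨ b = 1) := fun h1 => by
      -- Any second point refutes a strict maximum of a constant function.
      have h2 := h.2 (1 / Real.sqrt (a * b) + 1) (by linarith [h.1]) (by simp)
      rw [hsQuotient_eq_one ha hb (by linarith [h.1]) h1, hsQuotient_eq_one ha hb h.1 h1] at h2
      exact lt_irrefl _ h2
    rw [not_or] at hone
    rcases lt_or_gt_of_ne hone.1 with h1 | h1 <;> rcases lt_or_gt_of_ne hone.2 with h2 | h2
    · exact Or.inr ⟨h1, h2⟩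
    · exact absurd h (hmin (Or.inl ⟨h1, h2⟩)).not_max
    · exact absurd h (hmin (Or.inr ⟨h2, h1⟩)).not_max
    · exact Or.inl ⟨h1, h2⟩
  · rcases h with ⟨h1, h2⟩ | ⟨h1, h2⟩
    · exact mul_pos (Real.log_pos h1) (Real.log_pos h2)
    · exact mul_pos_of_neg_of_neg (Real.log_neg ha h1) (Real.log_neg hb h2)
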